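/- Let $S(x)=\frac{\sin \pi x}{\pi x}$ for $x\neq 0$ and $S(0)=1$. A configuration is a locally finite sequence $(u_j)_{j\in\mathbb Z}$ of real numbers, and $\#_V(u)$ denotes the number of indices $j$ with $u_j\in V$; random configurations are measurable with respect to the σ-algebra generated by the counts $\#_V$, $V$ Borel. A $\tfrac12$-discrete sine process is a random configuration $(w_j)$ of points of $\tfrac12\mathbb Z$ such that for all $n\ge 1$ and all $\varphi\in C_c(\mathbb R^n)$ the sum $\sum \varphi(w_{j_1},\dots,w_{j_n})$ over distinct indices $j_1,\dots,j_n$ is integrable and $$\mathbb E \sum_{j_1,\dots,j_n \text{ distinct}} \varphi(w_{j_1},\dots,w_{j_n}) = \frac1{2^n}\sum_{k\in(\frac12\mathbb Z)^n}\varphi(k)\det_{1\le i,j\le n}\big[S(k_i-k_j)\big].$$ The Alternative Hypothesis (AH) point process is the random configuration $(w_j-U)_j$, where $(w_j)$ is a $\tfrac12$-discrete sine process and $U$ is uniform on $[0,\tfrac12)$ and independent of it. For $L\ge 0$ let $\Sigma_L=\big(S(\tfrac{k-j}{2})\big)_{0\le j,k\le L-1}$ and $\omega(L)=\det(I-\tfrac12\Sigma_L)$,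 with $\omega(0)=1$. **Theorem.** Let $$G_{L/2}=\mathbb P\big[\#_{\{L/2\}}=1,\ \#_{\{1/2,\dots,(L-1)/2\}}=0\ \big|\ \#_{\{0\}}=1\big]$$ be computed for the $\tfrac12$-discrete sine process (the conditioning event has positive probability). Then for all integers $L\ge 1$ $$G_{L/2}=2\big(\omega(L+1)+\omega(L-1)-2\omega(L)\big).$$ The same number is the probability that a randomly chosen gap of the AH point process has size $L/2$: for every Borel set $B\subset\mathbb R$ of finite positive Lebesgue measure, the expected number of gaps of size $L/2$ with left endpoint in $B$, divided by the expected number of points in $B$, equals $2(\omega(L+1)+\omega(L-1)-2\omega(L))$. Here a point $x$ of a configuration is the left endpoint of a gap of size $g$ if $x+g$ is also a point of the configuration and no point lies in the open interval $(x,x+g)$. -/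

import Mathlib

open MeasureTheory ProbabilityTheory
open scoped ENNReal

namespace AH

noncomputable section

/-- The rescaled sinc function `S x = sin (π x) / (π x)`, with `S 0 = 1`. -/
def S (x : ℝ) : ℝ := if x = 0 then 1 else Real.sin (Real.pi * x) / (Real.pi * x)

/-- The lattice `aℤ` as a subset of `ℝ`. -/
def lattice (a : ℝ) : Set ℝ := Set.range fun m : ℤ => a * (m : ℝ)

/-- Locally finite configurations in `X ⊆ ℝ`: sequences of points of `X` indexed by `ℤ` (in no
particular order, repetitions allowed), with finitely many indices in every compact interval. -/
structure Conf (X : Set ℝ) where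
  /-- the points of the configuration -/
  pt : ℤ → ℝ
  mem : ∀ j, pt j ∈ X
  locallyFinite : ∀ s t : ℝ, {j : ℤ | pt j ∈ Set.Icc s t}.Finite

namespace Conf

variable {X : Set ℝ}

/-- `#_V(u)`, the number of members of the configuration `u` that lie in `V`. -/
def count (u : Conf X) (V : Set ℝ) : ℕ∞ := {j : ℤ | u.pt j ∈ V}.encard

/-- The σ-algebra of point process theory: it is generated by the sets `{u | #_V(u) = n}`. -/
instance : MeasurableSpace (Conf X) :=
  MeasurableSpace.generateFrom
    {C | ∃ (V : Set ℝ) (n : ℕ), MeasurableSet V ∧ C = {u : Conf X | u.count V = (n : ℕ∞)}}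

/-- The sum `∑ φ(u_{j₁}, …, u_{jₙ})` over all `n`-tuples of distinct indices. For `φ` of compact
support it has only finitely many nonzero terms. -/
def distinctSum (u : Conf X) {n : ℕ} (φ : (Fin n → ℝ) → ℂ) : ℂ :=
  ∑' j : Fin n ↪ ℤ, φ fun i => u.pt (j i)

/-- The configuration `(u_j - t)_j`, as a configuration in `ℝ`. -/
def shift (u : Conf X) (t : ℝ) : Conf Set.univ where
  pt j := u.pt j - t
  mem _ := Set.mem_univ _
  locallyFinite p q := by
    refine (u.locallyFinite (p + t) (q + t)).subset ?_
    intro j hj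
    obtain ⟨h1, h2⟩ := hj
    exact ⟨by linarith, by linarith⟩

/-- The member of `u` with index `j` is the left endpoint of a gap of size `g`: there is a member
of `u` at distance `g` to its right, and no member of `u` strictly in between. -/
def GapAt (u : Conf X) (j : ℤ) (g : ℝ) : Prop :=
  (∃ i, u.pt i = u.pt j + g) ∧ ∀ i, u.pt i ∉ Set.Ioo (u.pt j) (u.pt j + g)

/-- The number of gaps of `u` of size `g` whose left endpoint lies in `B`. -/
def gapCount (u : Conf X) (B : Set ℝ) (g : ℝ) : ℕ∞ :=
  {j : ℤ | u.pt j ∈ B ∧ u.GapAt j g}.encard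

end Conf

/-- `w` is an `a`-discrete sine process: a random configuration in `aℤ` whose `n`-point correlation
functions, with respect to `aⁿ` times counting measure on `(aℤ)ⁿ`, are `det [S (kᵢ - kⱼ)]` for all
`n ≥ 1`. -/
structure IsDiscreteSineProcess (a : ℝ) {Ω : Type*} [MeasurableSpace Ω] (P : Measure Ω)
    (w : Ω → Conf (lattice a)) : Prop where
  measurable : Measurable w
  integrable : ∀ n : ℕ, 1 ≤ n → ∀ φ : (Fin n → ℝ) → ℂ, Continuous φ → HasCompactSupport φ →
    Integrable (fun ω => (w ω).distinctSum φ) P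
  correlation : ∀ n : ℕ, 1 ≤ n → ∀ φ : (Fin n → ℝ) → ℂ, Continuous φ → HasCompactSupport φ →
    ∫ ω, (w ω).distinctSum φ ∂P =
      (a : ℂ) ^ n * ∑' m : Fin n → ℤ, φ (fun i => a * (m i : ℝ)) *
        ((Matrix.of fun i j : Fin n => S (a * (m i : ℝ) - a * (m j : ℝ))).det : ℂ)

/-- `v` is an Alternative Hypothesis point process on the probability space `(Ω, P)`: its
configurations are `(w_j - U)_j`, where `w` is a `1/2`-discrete sine process and `U` is uniform on
`[0, 1/2)` and independent of `w`. -/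
def IsAHProcess {Ω : Type*} [MeasurableSpace Ω] (P : Measure Ω) (v : Ω → Conf Set.univ) : Prop :=
  ∃ (w : Ω → Conf (lattice (1 / 2))) (U : Ω → ℝ),
    IsDiscreteSineProcess (1 / 2) P w ∧ Measurable U ∧
      pdf.IsUniform U (Set.Ico 0 (1 / 2)) P volume ∧ IndepFun w U P ∧
      ∀ ω, v ω = (w ω).shift (U ω)

/-- The gap probability `G_{L/2}`: the conditional probability that the position `L/2` is occupied
by exactly one point and the positions `1/2, …, (L-1)/2` are unoccupied, given that the position
`0` is occupied by exactly one point. -/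
def gapProb {Ω : Type*} [MeasurableSpace Ω] (P : Measure Ω) (w : Ω → Conf (lattice (1 / 2)))
    (L : ℕ) : ℝ≥0∞ :=
  (P[|{ω | (w ω).count {0} = 1}])
    {ω | (w ω).count {(L : ℝ) / 2} = 1 ∧
      (w ω).count {x : ℝ | ∃ i : ℕ, 1 ≤ i ∧ i < L ∧ x = (i : ℝ) / 2} = 0}

/-- The proportion of gaps of size `g` among the gaps with left endpoint in the window `B`: the
expected number of gaps of size `g` with left endpoint in `B` divided by the expected number of
points in `B`. -/
def gapFrequency {Ω : Type*} [MeasurableSpace Ω] (P : Measure Ω) (v : Ω → Conf Set.univ)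
    (B : Set ℝ) (g : ℝ) : ℝ≥0∞ :=
  (∫⁻ ω, ((v ω).gapCount B g : ℝ≥0∞) ∂P) / ∫⁻ ω, ((v ω).count B : ℝ≥0∞) ∂P

/-- The `L × L` Toeplitz matrix `Σ_L` with entries `S ((k - j) / 2)`, `0 ≤ j, k ≤ L - 1`. -/
def toeplitz (L : ℕ) : Matrix (Fin L) (Fin L) ℝ :=
  Matrix.of fun j k => S (((k : ℕ) - (j : ℕ) : ℝ) / 2)

/-- `ω(L) = det (I - Σ_L / 2)`. -/
def omega (L : ℕ) : ℝ := (1 - (1 / 2 : ℝ) • toeplitz L).det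

/-- The determinant of the empty matrix gives the convention `ω(0) = 1`. -/
theorem omega_zero : omega 0 = 1 := by simp [omega]

end

end AH

/-! Tent functions centred at lattice points turn the correlation identity into pointwise formulas
for counts of tuples at prescribed sites. At a repeated site the two-point determinant vanishes, so
almost surely no points coincide (`ae_count_le_one`), and the occupation indicators of distinct
sites have determinantal joint moments. Expanding a product of factors `1 - occ` and summing
principal minors shows that `n` consecutive sites are empty with probability `omega n`, wherever
they start (`integral_vacuum`). If `x`, `y` are the indicators at the two ends of a gap, then `x y =
1 - (1 - x) - (1 - y) + (1 - x)(1 - y)`. Multiplying by the vacuum indicator of the interior yields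
the second difference of `omega` (`measureReal_gapSet`); conditioning divides by the occupation
probability 1/2. For the AH process, averaging over `U` spreads the lattice uniformly: an event of
probability `q` at every site contributes `2 |B| q` (`lintegral_encard`), so the frequency is again
the ratio of `q` to 1/2. -/

namespace Matrix

/-- The determinant of `1 + M` is the sum of all principal minors of `M`. -/
theorem det_one_add_eq_sum_minors {n R : Type*} [Fintype n] [DecidableEq n] [CommRing R]
    (M : Matrix n n R) :
    (1 + M).det = ∑ s : Finset n, (M.submatrix ((↑) : s → n) ((↑) : s → n)).det := by
  -- Multilinearity in the rows: rows in `s` come from `M`, the others from the identity.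
  have h := (detRowAlternating : (n → R) [⋀^n]→ₗ[R] R).map_add_univ M.row (1 : Matrix n n R).row
  rw [add_comm]
  refine Eq.trans h (Finset.sum_congr rfl fun s _ => ?_)
  exact det_piecewise_one_eq_submatrix_det M s

end Matrix

namespace AH

noncomputable section

variable {a : ℝ} {Ω : Type*} [MeasurableSpace Ω] {P : Measure Ω}

/-! ### Tent test functions -/

/-- The product of tent functions of width `a` centred at the lattice points `a * k i`. -/
def tent (a : ℝ) {n : ℕ} (k : Fin n → ℤ) (x : Fin n → ℝ) : ℂ :=
  ((∏ i, max 0 (1 - |x i / a - k i|) : ℝ) : ℂ)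

theorem continuous_tent (a : ℝ) {n : ℕ} (k : Fin n → ℤ) : Continuous (tent a k) := by
  unfold tent
  fun_prop

theorem hasCompactSupport_tent (ha : 0 < a) {n : ℕ} (k : Fin n → ℤ) :
    HasCompactSupport (tent a k) := by
  refine HasCompactSupport.intro
    (isCompact_univ_pi fun i => isCompact_Icc (a := a * (k i - 1)) (b := a * (k i + 1))) ?_
  intro x hx
  simp only [Set.mem_pi, Set.mem_univ, true_imp_iff, not_forall] at hx
  obtain ⟨i, hi⟩ := hx
  rw [tent, Complex.ofReal_eq_zero, Finset.prod_eq_zero (Finset.mem_univ i)]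
  refine max_eq_left ?_
  by_contra! h
  refine hi ?_
  have h1 : |x i / a - k i| < 1 := by linarith
  rw [abs_lt, lt_sub_iff_add_lt, sub_lt_iff_lt_add, lt_div_iff₀ ha, div_lt_iff₀ ha] at h1
  exact ⟨by linarith, by linarith⟩

theorem tent_lattice (ha : a ≠ 0) {n : ℕ} (k m : Fin n → ℤ) :
    tent a k (fun i => a * (m i : ℝ)) = if m = k then 1 else 0 := by
  unfold tent
  simp only [mul_div_cancel_left₀ _ ha]
  split_ifs with h
  · simp [h]
  · obtain ⟨i, hi⟩ := Function.ne_iff.1 h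
    rw [Complex.ofReal_eq_zero, Finset.prod_eq_zero (Finset.mem_univ i)]
    refine max_eq_left ?_
    have h1 : (1 : ℤ) ≤ |m i - k i| := Int.one_le_abs (sub_ne_zero.2 hi)
    have h2 : (1 : ℝ) ≤ |(m i : ℝ) - k i| := by exact_mod_cast h1
    linarith

/-! ### Tuples of points and occupation indicators -/

namespace Conf

variable {X : Set ℝ}

theorem finite_pt_eq (u : Conf X) (x : ℝ) : {j : ℤ | u.pt j = x}.Finite := by
  simpa using u.locallyFinite x x

/-- The tuples of distinct indices at which a configuration takes the given values. -/
def tuples (u : Conf X) {n : ℕ} (x : Fin n → ℝ) : Set (Fin n ↪ ℤ) := {j | ∀ i, u.pt (j i) = x i}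

theorem finite_tuples (u : Conf X) {n : ℕ} (x : Fin n → ℝ) : (u.tuples x).Finite := by
  have h : (Set.univ.pi fun i => {j : ℤ | u.pt j = x i}).Finite :=
    Set.Finite.pi fun i => u.finite_pt_eq (x i)
  refine (h.preimage (f := fun j : Fin n ↪ ℤ => (j : Fin n → ℤ))
    DFunLike.coe_injective.injOn).subset ?_
  intro j hj i _
  exact hj i

/-- All points lie on the lattice, where the tent takes only the values 0 and 1. -/
theorem distinctSum_tent (ha : a ≠ 0) (u : Conf (lattice a)) {n : ℕ} (k : Fin n → ℤ) :
    u.distinctSum (tent a k) = ((u.tuples fun i => a * (k i : ℝ)).ncard : ℂ) := by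
  classical
  set T := u.tuples fun i => a * (k i : ℝ) with hT
  have hfin : T.Finite := u.finite_tuples _
  have h : ∀ j : Fin n ↪ ℤ, tent a k (fun i => u.pt (j i)) = if j ∈ T then 1 else 0 := by
    intro j
    choose m hm using fun i => u.mem (j i)
    have h1 : (fun i => u.pt (j i)) = fun i => a * (m i : ℝ) := funext fun i => (hm i).symm
    rw [h1, tent_lattice ha]
    congr 1
    simp only [hT, tuples, Set.mem_ofPred_eq, ← hm, mul_right_inj' ha, Int.cast_inj, funext_iff]
  unfold distinctSum
  simp only [h]
  rw [tsum_eq_sum (s := hfin.toFinset), Set.ncard_eq_toFinset_card T hfin]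
  · rw [Finset.sum_congr rfl fun j hj => if_pos (hfin.mem_toFinset.1 hj)]
    simp
  · intro j hj
    exact if_neg (by simpa using hj)

/-- The indicator of the event that exactly one point lies at `x`. -/
def occ (u : Conf X) (x : ℝ) : ℝ := if u.count {x} = 1 then 1 else 0

theorem measurableSet_count_eq {V : Set ℝ} (hV : MeasurableSet V) (n : ℕ) :
    MeasurableSet {u : Conf X | u.count V = (n : ℕ∞)} :=
  MeasurableSpace.measurableSet_generateFrom ⟨V, n, hV, rfl⟩

theorem measurableSet_count_singleton (x : ℝ) :
    MeasurableSet {u : Conf X | u.count {x} = 1} := by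
  simpa using measurableSet_count_eq (X := X) (measurableSet_singleton x) 1

theorem measurable_occ (x : ℝ) : Measurable fun u : Conf X => u.occ x :=
  Measurable.ite (measurableSet_count_singleton x) measurable_const measurable_const

theorem occ_nonneg (u : Conf X) (x : ℝ) : 0 ≤ u.occ x := by
  unfold occ
  split_ifs <;> norm_num

theorem occ_le_one (u : Conf X) (x : ℝ) : u.occ x ≤ 1 := by
  unfold occ
  split_ifs <;> norm_num

theorem count_le_one_iff (u : Conf X) (x : ℝ) :
    u.count {x} ≤ 1 ↔ ∀ i j, u.pt i = x → u.pt j = x → i = j := by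
  simp only [count, Set.encard_le_one_iff, Set.mem_ofPred_eq, Set.mem_singleton_iff]

theorem count_eq_zero_iff (u : Conf X) (V : Set ℝ) : u.count V = 0 ↔ ∀ j, u.pt j ∉ V := by
  simp [count, Set.eq_empty_iff_forall_notMem]

theorem count_eq_one_of_le {u : Conf X} {x : ℝ} (h : u.count {x} ≤ 1) {j : ℤ}
    (hj : u.pt j = x) : u.count {x} = 1 := by
  refine le_antisymm h (Order.one_le_iff_ne_zero.2 fun h0 => ?_)
  exact (u.count_eq_zero_iff _).1 h0 j hj

theorem exists_pt_eq {u : Conf X} {x : ℝ} (h : u.count {x} = 1) : ∃ j, u.pt j = x := by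
  obtain ⟨j, hj⟩ := Set.encard_eq_one.1 h
  exact ⟨j, (Set.ext_iff.1 hj j).2 rfl⟩

/-- Without coincidences each site determines at most one index, and distinct sites give distinct
indices. -/
theorem ncard_tuples {u : Conf X} (hu : ∀ x, u.count {x} ≤ 1) {n : ℕ} {x : Fin n → ℝ}
    (hx : Function.Injective x) : ((u.tuples x).ncard : ℝ) = ∏ i, u.occ (x i) := by
  by_cases h : ∀ i, u.count {x i} = 1
  · have h1 : ∏ i, u.occ (x i) = 1 := Finset.prod_eq_one fun i _ => if_pos (h i)
    choose j hj using fun i => exists_pt_eq (h i)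
    have hinj : Function.Injective j := fun i i' hii => hx (by rw [← hj, ← hj, hii])
    have h2 : u.tuples x = {⟨j, hinj⟩} := by
      ext j'
      simp only [tuples, Set.mem_ofPred_eq, Set.mem_singleton_iff]
      constructor
      · intro h'
        ext i
        exact (u.count_le_one_iff (x i)).1 (hu _) _ _ (h' i) (hj i)
      · rintro rfl i
        exact hj i
    rw [h1, h2, Set.ncard_singleton, Nat.cast_one]
  · push Not at h
    obtain ⟨i, hi⟩ := h
    rw [Finset.prod_eq_zero (Finset.mem_univ i) (if_neg hi)]
    have h2 : u.tuples x = ∅ := by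
      refine Set.eq_empty_iff_forall_notMem.2 fun j hj => hi ?_
      exact count_eq_one_of_le (hu _) (hj i)
    rw [h2, Set.ncard_empty, Nat.cast_zero]

end Conf

/-! ### Joint occupation and vacancy probabilities -/

namespace IsDiscreteSineProcess

variable {w : Ω → Conf (lattice a)}

theorem integrable_ncard_tuples (h : IsDiscreteSineProcess a P w) (ha : 0 < a) {n : ℕ}
    (hn : 1 ≤ n) (k : Fin n → ℤ) :
    Integrable (fun ω => (((w ω).tuples fun i => a * (k i : ℝ)).ncard : ℝ)) P := by
  have h1 := (h.integrable n hn _ (continuous_tent a k) (hasCompactSupport_tent ha k)).re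
  simpa [Conf.distinctSum_tent ha.ne'] using h1

theorem integral_ncard_tuples (h : IsDiscreteSineProcess a P w) (ha : 0 < a) {n : ℕ}
    (hn : 1 ≤ n) (k : Fin n → ℤ) :
    ∫ ω, (((w ω).tuples fun i => a * (k i : ℝ)).ncard : ℝ) ∂P =
      a ^ n * (Matrix.of fun i j : Fin n => S (a * (k i : ℝ) - a * (k j : ℝ))).det := by
  have h1 := h.correlation n hn _ (continuous_tent a k) (hasCompactSupport_tent ha k)
  rw [tsum_eq_single k] at h1
  · simp only [Conf.distinctSum_tent ha.ne', tent_lattice ha.ne', if_true, one_mul] at h1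
    simp only [← Complex.ofReal_natCast] at h1
    rw [integral_complex_ofReal] at h1
    exact_mod_cast h1
  · intro m hm
    rw [tent_lattice ha.ne', if_neg hm, zero_mul]

/-- Almost surely no two points coincide. -/
theorem ae_count_le_one (h : IsDiscreteSineProcess a P w) (ha : 0 < a) :
    ∀ᵐ ω ∂P, ∀ x, (w ω).count {x} ≤ 1 := by
  have key : ∀ᵐ ω ∂P, ∀ m : ℤ, (w ω).count {a * (m : ℝ)} ≤ 1 := by
    refine ae_all_iff.2 fun m => ?_
    -- Both sites are `m`, so all four matrix entries are `S 0` and the determinant vanishes.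
    have h1 := h.integral_ncard_tuples ha (n := 2) (by norm_num) fun _ => m
    rw [Matrix.det_fin_two] at h1
    simp only [Matrix.of_apply, sub_self, mul_zero] at h1
    rw [integral_eq_zero_iff_of_nonneg (fun ω => Nat.cast_nonneg _)
      (h.integrable_ncard_tuples ha (by norm_num) _)] at h1
    filter_upwards [h1] with ω hω
    rw [Conf.count_le_one_iff]
    intro i j hi hj
    by_contra hij
    have h2 : (w ω).tuples (fun _ : Fin 2 => a * (m : ℝ)) = ∅ := by
      rw [← Set.ncard_eq_zero (Conf.finite_tuples _ _)]
      exact Nat.cast_eq_zero.1 hω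
    have hinj : Function.Injective ![i, j] := by
      intro p q hpq
      fin_cases p <;> fin_cases q <;> simp_all
    refine Set.eq_empty_iff_forall_notMem.1 h2 ⟨![i, j], hinj⟩ fun p => ?_
    fin_cases p
    exacts [hi, hj]
  filter_upwards [key] with ω hω x
  by_cases hx : x ∈ lattice a
  · obtain ⟨m, rfl⟩ := hx
    exact hω m
  · rw [((w ω).count_eq_zero_iff {x}).2]
    · exact zero_le_one
    · intro j hj
      exact hx (hj ▸ (w ω).mem j)

theorem measurable_occ (h : IsDiscreteSineProcess a P w) (x : ℝ) :
    Measurable fun ω => (w ω).occ x :=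
  (Conf.measurable_occ x).comp h.measurable

variable [IsProbabilityMeasure P]

/-- The probability that all the positions `a * k i` are occupied. -/
theorem integral_prod_occ (h : IsDiscreteSineProcess a P w) (ha : 0 < a) {ι : Type*}
    [Fintype ι] [DecidableEq ι] {k : ι → ℤ} (hk : Function.Injective k) :
    ∫ ω, ∏ i, (w ω).occ (a * (k i : ℝ)) ∂P =
      a ^ Fintype.card ι * (Matrix.of fun i j => S (a * (k i : ℝ) - a * (k j : ℝ))).det := by
  -- The correlation identity is only available for `n ≥ 1`.
  rcases isEmpty_or_nonempty ι with hι | hι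
  · simp
  let e := Fintype.equivFin ι
  have hinj : Function.Injective fun i => a * (k (e.symm i) : ℝ) := by
    intro i j hij
    exact e.symm.injective (hk (Int.cast_injective (mul_left_cancel₀ ha.ne' hij)))
  rw [← Matrix.det_submatrix_equiv_self e.symm]
  refine Eq.trans ?_ (h.integral_ncard_tuples ha Fintype.card_pos fun i => k (e.symm i))
  refine integral_congr_ae ?_
  filter_upwards [h.ae_count_le_one ha] with ω hω
  rw [Conf.ncard_tuples hω hinj]
  exact (Equiv.prod_comp e.symm fun i => (w ω).occ (a * (k i : ℝ))).symm

theorem integrable_prod_occ (h : IsDiscreteSineProcess a P w) {ι : Type*} (s : Finset ι)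
    (x : ι → ℝ) : Integrable (fun ω => ∏ i ∈ s, (w ω).occ (x i)) P := by
  refine Integrable.of_bound (C := 1)
    (Finset.measurable_prod s fun i _ => h.measurable_occ (x i)).aestronglyMeasurable
    (ae_of_all _ fun ω => ?_)
  rw [Real.norm_of_nonneg (Finset.prod_nonneg fun i _ => (w ω).occ_nonneg _)]
  exact Finset.prod_le_one (fun i _ => (w ω).occ_nonneg _) fun i _ => (w ω).occ_le_one _

/-- The probability that none of the positions `a * k i` is occupied. -/
theorem integral_prod_one_sub_occ (h : IsDiscreteSineProcess a P w) (ha : 0 < a) {ι : Type*}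
    [Fintype ι] [DecidableEq ι] {k : ι → ℤ} (hk : Function.Injective k) :
    ∫ ω, ∏ i, (1 - (w ω).occ (a * (k i : ℝ))) ∂P =
      (1 - a • Matrix.of fun i j => S (a * (k i : ℝ) - a * (k j : ℝ))).det := by
  have h1 : ∀ ω, ∏ i, (1 - (w ω).occ (a * (k i : ℝ))) =
      ∑ s : Finset ι, (-1) ^ s.card * ∏ i ∈ s, (w ω).occ (a * (k i : ℝ)) := by
    intro ω
    simp only [sub_eq_add_neg, Finset.prod_one_add, Finset.powerset_univ, Finset.prod_neg]
  simp only [h1]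
  rw [integral_finsetSum _ fun s _ => (h.integrable_prod_occ s _).const_mul _, sub_eq_add_neg,
    Matrix.det_one_add_eq_sum_minors]
  refine Finset.sum_congr rfl fun s _ => ?_
  rw [integral_const_mul]
  have h2 := h.integral_prod_occ ha (k := fun i : s => k i) (hk.comp Subtype.val_injective)
  have h3 : ∀ ω, ∏ i : s, (w ω).occ (a * (k i : ℝ)) = ∏ i ∈ s, (w ω).occ (a * (k i : ℝ)) :=
    fun ω => Finset.prod_coe_sort s fun i => (w ω).occ (a * (k i : ℝ))
  simp only [h3] at h2
  -- The inclusion-exclusion sign is absorbed as the factor `(-a) ^ card` of a minor of `-a • S`.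
  rw [h2, ← neg_smul]
  change _ = ((-a) • (Matrix.of fun i j : s => S (a * (k i : ℝ) - a * (k j : ℝ)))).det
  rw [Matrix.det_smul, neg_pow a, Fintype.card_coe]
  ring

end IsDiscreteSineProcess

end

noncomputable section

/-! ### Gap events on the half-integer lattice -/

namespace Conf

/-- Exactly one point lies at `m / 2` and at `(m + L) / 2`, and none lies in between. -/
def gapSet (m : ℤ) (L : ℕ) : Set (Conf (lattice (1 / 2))) :=
  {u | u.count {1 / 2 * (m : ℝ)} = 1 ∧ u.count {1 / 2 * ((m : ℝ) + L)} = 1 ∧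
    u.count (Set.Ioo (1 / 2 * (m : ℝ)) (1 / 2 * ((m : ℝ) + L))) = 0}

theorem measurableSet_gapSet (m : ℤ) (L : ℕ) : MeasurableSet (gapSet m L) := by
  refine (measurableSet_count_singleton _).inter ((measurableSet_count_singleton _).inter ?_)
  exact measurableSet_count_eq measurableSet_Ioo 0

theorem indicator_gapSet {u : Conf (lattice (1 / 2))} (hu : ∀ x, u.count {x} ≤ 1) (m : ℤ)
    (L : ℕ) : (gapSet m (L + 1)).indicator 1 u =
      u.occ (1 / 2 * (m : ℝ)) * u.occ (1 / 2 * ((m : ℝ) + (L + 1 : ℕ))) *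
        ∏ i ∈ Finset.range L, (1 - u.occ (1 / 2 * ((m : ℝ) + 1 + i))) := by
  by_cases h1 : u.count {1 / 2 * (m : ℝ)} = 1
  swap
  · rw [Set.indicator_of_notMem fun h => h1 h.1, occ, if_neg h1, zero_mul, zero_mul]
  by_cases h2 : u.count {1 / 2 * ((m : ℝ) + (L + 1 : ℕ))} = 1
  swap
  · rw [Set.indicator_of_notMem fun h => h2 h.2.1, occ, occ, if_neg h2, mul_zero, zero_mul]
  rw [occ, occ, if_pos h1, if_pos h2, one_mul, one_mul]
  by_cases h3 : u.count (Set.Ioo (1 / 2 * (m : ℝ)) (1 / 2 * ((m : ℝ) + (L + 1 : ℕ)))) = 0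
  · rw [Set.indicator_of_mem (show u ∈ gapSet m (L + 1) from ⟨h1, h2, h3⟩),
      Finset.prod_eq_one fun i hi => ?_, Pi.one_apply]
    rw [occ, if_neg fun h => ?_, sub_zero]
    obtain ⟨j, hj⟩ := exists_pt_eq h
    refine (u.count_eq_zero_iff _).1 h3 j ?_
    have hi' : (i : ℝ) < L := by exact_mod_cast Finset.mem_range.1 hi
    have hi0 : (0 : ℝ) ≤ i := Nat.cast_nonneg i
    rw [hj]
    push_cast
    exact ⟨by linarith, by linarith⟩
  · rw [Set.indicator_of_notMem fun h => h3 h.2.2]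
    simp only [count_eq_zero_iff, not_forall, not_not] at h3
    obtain ⟨j, hj⟩ := h3
    obtain ⟨n, hn⟩ := u.mem j
    rw [← hn] at hj
    have hj1 : m < n := by
      have : (m : ℝ) < n := by linarith [hj.1]
      exact_mod_cast this
    have hj2 : n < m + (L + 1 : ℕ) := by
      have : (n : ℝ) < m + (L + 1 : ℕ) := by linarith [hj.2]
      exact_mod_cast this
    -- An interior point at site `n` kills the factor of index `n - m - 1`, since the product starts
    -- at site `m + 1`.
    have hi : ((n - m - 1).toNat : ℤ) = n - m - 1 := Int.toNat_of_nonneg (by lia)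
    have hi' : (((n - m - 1).toNat : ℕ) : ℝ) = n - m - 1 := by exact_mod_cast hi
    rw [Finset.prod_eq_zero (i := (n - m - 1).toNat) (Finset.mem_range.2 (by lia))]
    rw [occ, if_pos, sub_self]
    refine count_eq_one_of_le (hu _) (j := j) ?_
    rw [← hn, hi']
    ring

/-- In a configuration without coinciding points, the points may be counted by their positions. -/
theorem encard_eq_tsum {a : ℝ} (ha : a ≠ 0) {u : Conf (lattice a)} (hu : ∀ x, u.count {x} ≤ 1)
    (A : Set ℝ) (Q : ℤ → Prop) :
    (({j : ℤ | u.pt j ∈ A ∧ Q j}.encard : ℕ∞) : ℝ≥0∞) =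
      ∑' m : ℤ, {m : ℤ | a * (m : ℝ) ∈ A ∧ ∃ j, u.pt j = a * (m : ℝ) ∧ Q j}.indicator 1 m := by
  choose f hf' using u.mem
  have hf : ∀ j, a * (f j : ℝ) = u.pt j := hf'
  -- Absence of coincidences makes the map from indices to sites injective.
  have hinj : Function.Injective f := fun i j hij =>
    (u.count_le_one_iff (u.pt j)).1 (hu _) i j (by rw [← hf i, ← hf j, hij]) rfl
  have himg : f '' {j : ℤ | u.pt j ∈ A ∧ Q j} =
      {m : ℤ | a * (m : ℝ) ∈ A ∧ ∃ j, u.pt j = a * (m : ℝ) ∧ Q j} := by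
    ext m
    constructor
    · rintro ⟨j, ⟨h1, h2⟩, rfl⟩
      exact ⟨by rwa [hf j], j, (hf j).symm, h2⟩
    · rintro ⟨h1, j, h2, h3⟩
      refine ⟨j, ⟨h2 ▸ h1, h3⟩, ?_⟩
      have h4 := (hf j).trans h2
      exact_mod_cast mul_left_cancel₀ ha h4
  rw [← hinj.encard_image, himg, ← ENNReal.tsum_set_one, ← tsum_subtype]
  rfl

end Conf

theorem S_zero : S 0 = 1 := if_pos rfl

/-! ### Gap probabilities of the discrete process -/

namespace IsDiscreteSineProcess

variable {Ω : Type*} [MeasurableSpace Ω] {P : Measure Ω} [IsProbabilityMeasure P]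
  {w : Ω → Conf (lattice (1 / 2))}

theorem integral_vacuum (h : IsDiscreteSineProcess (1 / 2) P w) (c : ℤ) (L : ℕ) :
    ∫ ω, ∏ i ∈ Finset.range L, (1 - (w ω).occ (1 / 2 * ((c : ℝ) + i))) ∂P = omega L := by
  have hk : Function.Injective fun i : Fin L => c + (i : ℤ) := by
    intro i j hij
    exact Fin.ext (by simpa using hij)
  have h1 := h.integral_prod_one_sub_occ (by norm_num) hk
  simp only [Int.cast_add, Int.cast_natCast] at h1
  simp only [Finset.prod_range]
  -- `toeplitz` uses column minus row, the correlation kernel row minus column.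
  rw [h1, omega, ← Matrix.det_transpose]
  congr 1
  rw [Matrix.transpose_sub, Matrix.transpose_one, Matrix.transpose_smul]
  congr 2
  ext i j
  simp only [Matrix.transpose_apply, Matrix.of_apply, toeplitz]
  congr 1
  ring

theorem measureReal_gapSet (h : IsDiscreteSineProcess (1 / 2) P w) (m : ℤ) (L : ℕ) :
    P.real (w ⁻¹' Conf.gapSet m (L + 1)) = omega (L + 2) + omega L - 2 * omega (L + 1) := by
  have hint : ∀ (c : ℤ) (n : ℕ),
      Integrable (fun ω => ∏ i ∈ Finset.range n, (1 - (w ω).occ (1 / 2 * ((c : ℝ) + i)))) P := by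
    intro c n
    refine Integrable.of_bound (C := 1) (Finset.measurable_prod _ fun i _ =>
      (h.measurable_occ _).const_sub 1).aestronglyMeasurable (ae_of_all _ fun ω => ?_)
    have h0 : ∀ i : ℕ, 0 ≤ 1 - (w ω).occ (1 / 2 * ((c : ℝ) + i)) :=
      fun i => sub_nonneg.2 ((w ω).occ_le_one _)
    rw [Real.norm_of_nonneg (Finset.prod_nonneg fun i _ => h0 i)]
    exact Finset.prod_le_one (fun i _ => h0 i) fun i _ => sub_le_self _ ((w ω).occ_nonneg _)
  rw [← integral_indicator_one (h.measurable (Conf.measurableSet_gapSet m (L + 1)))]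
  -- Inclusion-exclusion over the two endpoints; the four products are vacuum indicators of runs
  -- containing both, neither, only the left, or only the right endpoint.
  have key : (w ⁻¹' Conf.gapSet m (L + 1)).indicator (1 : Ω → ℝ) =ᵐ[P] fun ω =>
      ((∏ i ∈ Finset.range (L + 2), (1 - (w ω).occ (1 / 2 * ((m : ℝ) + i)))) +
        ∏ i ∈ Finset.range L, (1 - (w ω).occ (1 / 2 * (((m + 1 : ℤ) : ℝ) + i)))) -
      ((∏ i ∈ Finset.range (L + 1), (1 - (w ω).occ (1 / 2 * ((m : ℝ) + i)))) +
        ∏ i ∈ Finset.range (L + 1), (1 - (w ω).occ (1 / 2 * (((m + 1 : ℤ) : ℝ) + i)))) := by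
    filter_upwards [h.ae_count_le_one (by norm_num)] with ω hω
    refine (Conf.indicator_gapSet hω m L).trans ?_
    have hs : ∀ i : ℕ, (m : ℝ) + (i + 1 : ℕ) = m + 1 + i := fun i => by push_cast; ring
    have e1 : ∀ n : ℕ, ∏ i ∈ Finset.range (n + 1), (1 - (w ω).occ (1 / 2 * ((m : ℝ) + i))) =
        (∏ i ∈ Finset.range n, (1 - (w ω).occ (1 / 2 * ((m : ℝ) + 1 + i)))) *
          (1 - (w ω).occ (1 / 2 * (m : ℝ))) := by
      intro n
      rw [Finset.prod_range_succ']
      simp only [hs, Nat.cast_zero, add_zero]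
    simp only [e1, Finset.prod_range_succ, Int.cast_add, Int.cast_one, hs]
    ring
  have e1 := integral_sub ((hint m (L + 2)).add (hint (m + 1) L))
    ((hint m (L + 1)).add (hint (m + 1) (L + 1)))
  rw [integral_add' (hint _ _) (hint _ _), integral_add' (hint _ _) (hint _ _)] at e1
  simp only [h.integral_vacuum] at e1
  refine (integral_congr_ae key).trans (e1.trans ?_)
  ring

theorem measureReal_count_eq_one (h : IsDiscreteSineProcess (1 / 2) P w) (m : ℤ) :
    P.real (w ⁻¹' {u | u.count {1 / 2 * (m : ℝ)} = 1}) = 1 / 2 := by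
  rw [← integral_indicator_one (h.measurable (Conf.measurableSet_count_singleton _))]
  have h1 := h.integral_prod_occ (by norm_num) (k := fun _ : Unit => m)
    (Function.injective_of_subsingleton _)
  simp only [Finset.univ_unique, Finset.prod_singleton, Matrix.det_unique, Matrix.of_apply,
    sub_self, S_zero, Fintype.card_unit, pow_one, mul_one] at h1
  refine Eq.trans (integral_congr_ae (ae_of_all _ fun ω => ?_)) h1
  by_cases hω : (w ω).count {1 / 2 * (m : ℝ)} = 1
  · rw [Set.indicator_of_mem (s := w ⁻¹' _)
      (show w ω ∈ {u | u.count {1 / 2 * (m : ℝ)} = 1} from hω),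
      Conf.occ, if_pos hω, Pi.one_apply]
  · rw [Set.indicator_of_notMem (s := w ⁻¹' _)
      (show w ω ∉ {u | u.count {1 / 2 * (m : ℝ)} = 1} from hω),
      Conf.occ, if_neg hω]

theorem toReal_gapProb (h : IsDiscreteSineProcess (1 / 2) P w) (L : ℕ) :
    (gapProb P w (L + 1)).toReal = 2 * (omega (L + 2) + omega L - 2 * omega (L + 1)) := by
  have h0 : {ω | (w ω).count {0} = 1} = w ⁻¹' {u | u.count {1 / 2 * ((0 : ℤ) : ℝ)} = 1} := by
    simp only [Int.cast_zero, mul_zero]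
    rfl
  have hset : {ω | (w ω).count {0} = 1} ∩ {ω | (w ω).count {((L + 1 : ℕ) : ℝ) / 2} = 1 ∧
      (w ω).count {x : ℝ | ∃ i : ℕ, 1 ≤ i ∧ i < L + 1 ∧ x = (i : ℝ) / 2} = 0} =
      w ⁻¹' Conf.gapSet 0 (L + 1) := by
    ext ω
    have e1 : (1 / 2 * (((0 : ℤ) : ℝ) + (L + 1 : ℕ))) = ((L + 1 : ℕ) : ℝ) / 2 := by
      push_cast
      ring
    have e0 : 1 / 2 * ((0 : ℤ) : ℝ) = 0 := by simp
    have e2 : (w ω).count {x : ℝ | ∃ i : ℕ, 1 ≤ i ∧ i < L + 1 ∧ x = (i : ℝ) / 2} = 0 ↔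
        (w ω).count (Set.Ioo 0 (((L + 1 : ℕ) : ℝ) / 2)) = 0 := by
      simp only [Conf.count_eq_zero_iff]
      refine forall_congr' fun j => not_congr ?_
      obtain ⟨n, hn⟩ := (w ω).mem j
      rw [← hn]
      constructor
      · rintro ⟨i, hi1, hi2, hi⟩
        have h1 : (1 : ℝ) ≤ i := by exact_mod_cast hi1
        have h2 : (i : ℝ) < (L + 1 : ℕ) := by exact_mod_cast hi2
        change 1 / 2 * (n : ℝ) = i / 2 at hi
        exact ⟨by linarith, by linarith⟩
      · rintro ⟨h1, h2⟩
        have h1' : 0 < n := by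
          have : (0 : ℝ) < n := by linarith
          exact_mod_cast this
        have h2' : n < (L + 1 : ℕ) := by
          have : (n : ℝ) < (L + 1 : ℕ) := by linarith
          exact_mod_cast this
        lift n to ℕ using h1'.le
        exact ⟨n, by lia, by lia, by push_cast; ring⟩
    simp only [Set.mem_inter_iff, Set.mem_preimage, Conf.gapSet, Set.mem_ofPred_eq, e0, e1, e2]
  rw [gapProb, cond_apply (by rw [h0]; exact h.measurable (Conf.measurableSet_count_singleton _)),
    hset, h0, ENNReal.toReal_mul, ENNReal.toReal_inv]
  change (P.real _)⁻¹ * P.real _ = _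
  rw [h.measureReal_count_eq_one, h.measureReal_gapSet]
  norm_num

/-! ### Averaging over the uniform shift -/

/-- The expected number of points `x` of `w` with `x - U ∈ B` that satisfy a condition `F` relative
to their position. -/
theorem lintegral_encard (h : IsDiscreteSineProcess (1 / 2) P w) {U : Ω → ℝ}
    (hU : pdf.IsUniform U (Set.Ico 0 (1 / 2)) P volume) (hi : IndepFun w U P) {B : Set ℝ}
    (hB : MeasurableSet B) {F : ℤ → Set (Conf (lattice (1 / 2)))} (hF : ∀ m, MeasurableSet (F m))
    (hUm : Measurable U) {q : ℝ} (hq : ∀ m, P.real (w ⁻¹' F m) = q)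
    {Q : Conf (lattice (1 / 2)) → ℤ → Prop}
    (hQ : ∀ u : Conf (lattice (1 / 2)), (∀ x, u.count {x} ≤ 1) →
      ∀ m : ℤ, (∃ j, u.pt j = 1 / 2 * (m : ℝ) ∧ Q u j) ↔ u ∈ F m) :
    ∫⁻ ω, (({j : ℤ | (w ω).pt j - U ω ∈ B ∧ Q (w ω) j}.encard : ℕ∞) : ℝ≥0∞) ∂P =
      2 * volume B * ENNReal.ofReal q := by
  have hP : ∀ m, P (w ⁻¹' F m) = ENNReal.ofReal q := fun m => by
    rw [← hq m, ofReal_measureReal]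
  have hBm : ∀ m : ℤ, MeasurableSet {t : ℝ | 1 / 2 * (m : ℝ) - t ∈ B} := fun m =>
    (measurable_id.const_sub _) hB
  -- `U` has density 2, and the ranges `((m - 1) / 2, m / 2]` of `m / 2 - U` tile the line.
  have hvol : ∑' m : ℤ, P (U ⁻¹' {t : ℝ | 1 / 2 * (m : ℝ) - t ∈ B}) = 2 * volume B := by
    have hI : volume (Set.Ico (0 : ℝ) (1 / 2)) = 2⁻¹ := by
      rw [Real.volume_Ico, sub_zero, one_div, ENNReal.ofReal_inv_of_pos two_pos]
      simp
    have h1 : ∀ m : ℤ, P (U ⁻¹' {t : ℝ | 1 / 2 * (m : ℝ) - t ∈ B}) =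
        2 * volume (B ∩ Set.Ioc (-(1 / 2) + m • (1 / 2 : ℝ)) (-(1 / 2) + (m + 1) • (1 / 2 : ℝ))) := by
      intro m
      rw [hU.measure_preimage (by simp) (by simp) (hBm m), hI, div_eq_mul_inv, inv_inv,
        mul_comm]
      congr 1
      rw [← (Measure.measurePreserving_sub_left volume (1 / 2 * (m : ℝ))).measure_preimage
        (hB.inter measurableSet_Ioc).nullMeasurableSet]
      congr 1
      ext t
      simp only [Set.mem_inter_iff, Set.mem_Ico, Set.mem_ofPred_eq, Set.mem_preimage, Set.mem_Ioc,
        zsmul_eq_mul, Int.cast_add, Int.cast_one]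
      constructor
      · rintro ⟨⟨h1, h2⟩, h3⟩
        exact ⟨h3, by linarith, by linarith⟩
      · rintro ⟨h3, h1, h2⟩
        exact ⟨⟨by linarith, by linarith⟩, h3⟩
    simp only [h1]
    rw [ENNReal.tsum_mul_left, ← measure_iUnion, ← Set.inter_iUnion, iUnion_Ioc_add_zsmul
      (by norm_num), Set.inter_univ]
    · intro i j hij
      exact (Set.pairwise_disjoint_Ioc_add_zsmul (-(1 / 2) : ℝ) (1 / 2) hij).mono
        Set.inter_subset_right Set.inter_subset_right
    · exact fun m => hB.inter measurableSet_Ioc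
  have key : ∀ᵐ ω ∂P, (({j : ℤ | (w ω).pt j - U ω ∈ B ∧ Q (w ω) j}.encard : ℕ∞) : ℝ≥0∞) =
      ∑' m : ℤ, (w ⁻¹' F m ∩ U ⁻¹' {t : ℝ | 1 / 2 * (m : ℝ) - t ∈ B}).indicator 1 ω := by
    filter_upwards [h.ae_count_le_one (by norm_num)] with ω hω
    refine (Conf.encard_eq_tsum (by norm_num) hω {x | x - U ω ∈ B} (Q (w ω))).trans ?_
    refine tsum_congr fun m => ?_
    classical
    rw [Set.indicator_apply, Set.indicator_apply]
    refine if_congr ?_ rfl rfl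
    simp only [Set.mem_ofPred_eq, hQ _ hω m, Set.mem_inter_iff, Set.mem_preimage]
    exact and_comm
  have hm : ∀ m : ℤ, MeasurableSet (w ⁻¹' F m ∩ U ⁻¹' {t : ℝ | 1 / 2 * (m : ℝ) - t ∈ B}) :=
    fun m => (h.measurable (hF m)).inter (hUm (hBm m))
  rw [lintegral_congr_ae key, lintegral_tsum fun m => (measurable_one.indicator (hm m)).aemeasurable]
  simp only [lintegral_indicator_one (hm _)]
  simp only [hi.measure_inter_preimage_eq_mul _ _ (hF _) (hBm _), hP]
  rw [ENNReal.tsum_mul_left, hvol, mul_comm]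

end IsDiscreteSineProcess

theorem gapFrequency_eq {Ω : Type*} [MeasurableSpace Ω] {P : Measure Ω} [IsProbabilityMeasure P]
    {v : Ω → Conf Set.univ} (hv : IsAHProcess P v) {B : Set ℝ} (hB : MeasurableSet B)
    (h0 : volume B ≠ 0) (htop : volume B ≠ ⊤) (L : ℕ) :
    gapFrequency P v B (((L + 1 : ℕ) : ℝ) / 2) =
      ENNReal.ofReal (2 * (omega (L + 2) + omega L - 2 * omega (L + 1))) := by
  obtain ⟨w, U, h, hUm, hU, hi, hvw⟩ := hv
  have hcount : ∫⁻ ω, ((v ω).count B : ℝ≥0∞) ∂P = 2 * volume B * ENNReal.ofReal (1 / 2) := by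
    rw [← h.lintegral_encard hU hi hB (fun m => Conf.measurableSet_count_singleton _) hUm
      h.measureReal_count_eq_one (Q := fun _ _ => True)]
    · simp only [hvw, Conf.count, Conf.shift, and_true]
    · intro u hu m
      simp only [and_true]
      exact ⟨fun ⟨j, hj⟩ => Conf.count_eq_one_of_le (hu _) hj, Conf.exists_pt_eq⟩
  have hgap : ∫⁻ ω, ((v ω).gapCount B (((L + 1 : ℕ) : ℝ) / 2) : ℝ≥0∞) ∂P =
      2 * volume B * ENNReal.ofReal (omega (L + 2) + omega L - 2 * omega (L + 1)) := by
    rw [← h.lintegral_encard hU hi hB (fun m => Conf.measurableSet_gapSet m (L + 1)) hUm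
      (fun m => h.measureReal_gapSet m L)
      (Q := fun u j => u.GapAt j (((L + 1 : ℕ) : ℝ) / 2))]
    · refine lintegral_congr fun ω => ?_
      rw [hvw, Conf.gapCount]
      congr 2
      ext j
      have e : ∀ x y g t : ℝ, x - t = y - t + g ↔ x = y + g := fun x y g t => by
        constructor <;> intro h <;> linarith
      have e' : ∀ x y g t : ℝ, y - t < x - t ∧ x - t < y - t + g ↔ y < x ∧ x < y + g :=
        fun x y g t => by constructor <;> rintro ⟨h1, h2⟩ <;> constructor <;> linarith
      simp only [Conf.GapAt, Conf.shift, Set.mem_Ioo, Set.mem_ofPred_eq, e, e']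
    · intro u hu m
      have e : 1 / 2 * (m : ℝ) + ((L + 1 : ℕ) : ℝ) / 2 = 1 / 2 * ((m : ℝ) + (L + 1 : ℕ)) := by ring
      constructor
      · rintro ⟨j, hj, ⟨i, hi⟩, hI⟩
        rw [hj, e] at hi hI
        exact ⟨Conf.count_eq_one_of_le (hu _) hj, Conf.count_eq_one_of_le (hu _) hi,
          (u.count_eq_zero_iff _).2 hI⟩
      · rintro ⟨h1, h2, h3⟩
        obtain ⟨j, hj⟩ := Conf.exists_pt_eq h1
        obtain ⟨i, hi⟩ := Conf.exists_pt_eq h2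
        refine ⟨j, hj, ⟨i, ?_⟩, ?_⟩
        · rw [hi, hj, e]
        · rw [hj, e]
          exact (u.count_eq_zero_iff _).1 h3
  have hne : 2 * volume B ≠ 0 := mul_ne_zero two_ne_zero h0
  have hne' : 2 * volume B ≠ ⊤ := ENNReal.mul_ne_top (by simp) htop
  rw [gapFrequency, hcount, hgap, ENNReal.mul_div_mul_left _ _ hne hne',
    ← ENNReal.ofReal_div_of_pos (by norm_num)]
  congr 1
  ring

end

end AH

theorem theoremB1 :
    -- the gap probabilities of the `1/2`-discrete sine process
    (∀ {Ω : Type*} [MeasurableSpace Ω] (P : Measure Ω) [IsProbabilityMeasure P]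
        (w : Ω → AH.Conf (AH.lattice (1 / 2))), AH.IsDiscreteSineProcess (1 / 2) P w →
      P {ω | (w ω).count {0} = 1} ≠ 0 ∧
      ∀ L : ℕ, 1 ≤ L →
        (AH.gapProb P w L).toReal =
          2 * (AH.omega (L + 1) + AH.omega (L - 1) - 2 * AH.omega L)) ∧
    -- the gap probabilities of the AH point process
    (∀ {Ω : Type*} [MeasurableSpace Ω] (P : Measure Ω) [IsProbabilityMeasure P]
        (v : Ω → AH.Conf Set.univ), AH.IsAHProcess P v →
      ∀ B : Set ℝ, MeasurableSet B → volume B ≠ 0 → volume B ≠ ⊤ →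
      ∀ L : ℕ, 1 ≤ L →
        AH.gapFrequency P v B ((L : ℝ) / 2) =
          ENNReal.ofReal (2 * (AH.omega (L + 1) + AH.omega (L - 1) - 2 * AH.omega L))) := by
  refine ⟨fun P _ w h => ⟨fun h0 => ?_, fun L hL => ?_⟩,
    fun P _ v hv B hB h0 htop L hL => ?_⟩
  · have h1 := h.measureReal_count_eq_one 0
    simp only [Int.cast_zero, mul_zero] at h1
    rw [Measure.real, show P (w ⁻¹' {u | u.count {0} = 1}) = 0 from h0] at h1
    norm_num at h1
  -- Replacing `L` by `L + 1` removes the truncated subtraction `L - 1`.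
  · obtain ⟨L, rfl⟩ := Nat.exists_eq_add_of_le' hL
    exact h.toReal_gapProb L
  · obtain ⟨L, rfl⟩ := Nat.exists_eq_add_of_le' hL
    exact AH.gapFrequency_eq hv hB h0 htop L
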